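/- Write points of the plane in homogeneous coordinates $\mathbf t=(t_1,t_2,t_3)\in\mathbb R^3$, $t_1+t_2+t_3=0$, and let $\mathbb H$ be the set of those with integer coordinates. Let $$\Omega=\{\mathbf t: t_1+t_2+t_3=0,\ -1\le t_1,t_2,t_3\le 1\},\qquad \Delta=\{\mathbf t: t_1+t_2+t_3=0,\ 0\le t_1,t_2,-t_3\le 1\}$$ be the closed regular hexagon and the closed equilateral triangle. For an integer $n\ge 1$ put $$\mathbb K_n^*=\{\mathbf j\in\mathbb H: |j_1|,|j_2|,|j_3|\le n,\ j_1\equiv j_2\equiv j_3 \!\!\pmod 3\},\qquad \mathbb K_n^{\dagger *}=\{\mathbf j\in\mathbb H: |j_2-j_1|,|j_1-j_3|,|j_2-j_3|\le n\},$$ $$\Upsilon_n=\{\mathbf j\in\mathbb K_n^*: j_1,j_2,-j_3\ge 0\},\qquad \Upsilon_n^\circ=\{\mathbf j\in\Upsilon_n: j_1>0,\ j_2>0,\ -j_3<n\},$$ $$\Upsilon_n^\dagger=\{\mathbf k\in\mathbb H: 0\le k_1,k_2,-k_3\le n,\ k_2-k_3\le n,\ k_1-k_3\le n\},\qquad \Upsilon_n^{\dagger\circ}=\{\mathbf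 k\in\Upsilon_n^\dagger: k_1>0,\ k_2>0\}.$$ Let $\phi_{\mathbf k}(\mathbf t)=e^{\frac{2\pi i}{3}\mathbf k\cdot\mathbf t}$ and $\widehat{\mathbf k}=(k_3-k_2,k_1-k_3,k_2-k_1)$. For $\mathbf j\in\mathbb H$ with $|j_i|\le n$ let $c_{\mathbf j}^{(n)}$ be $1$, $\frac12$ or $\frac13$ according to whether none, exactly one, or two of the $|j_i|$ equal $n$. For $\mathbf j\in\Upsilon_n$ let $\lambda_{\mathbf j}^{(n)}$ be $6$ if $\mathbf j\in\Upsilon_n^\circ$, $1$ if $\mathbf j$ is one of the corners $(0,0,0),(n,0,-n),(0,n,-n)$, and $3$ otherwise. Let $\mathcal A_2$ be the group of the six maps $\mathbf t\mapsto\mathbf t\sigma$ consisting of the three cyclic permutations of coordinates (sign $+1$) and the three reflections $\mathbf t\mapsto -(t_1,t_3,t_2),\,-(t_2,t_1,t_3),\,-(t_3,t_2,t_1)$ (sign $-1$), and let $$\mathsf{TC}_{\mathbf k}(\mathbf t)=\frac16\sum_{\sigma\in\mathcal A_2}\phi_{\mathbf k}(\mathbf t\sigma),\qquad \mathsf{TS}_{\mathbf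 k}(\mathbf t)=\frac1{6i}\sum_{\sigma\in\mathcal A_2}\operatorname{sign}(\sigma)\,\phi_{\mathbf k}(\mathbf t\sigma),\qquad \widehat\lambda_{\mathbf k}^{(n)}=c_{\widehat{\mathbf k}}^{(n)}\,|\mathbf k\mathcal A_2| ,$$ where $|\mathbf k\mathcal A_2|$ is the cardinality of the orbit of $\mathbf k$. Define, for continuous complex-valued $f$ on $\Omega$, $$\mathcal I_n^*f(\mathbf t)=\sum_{\mathbf j\in\mathbb K_n^*}f(\tfrac{\mathbf j}{n})\,\Phi_n(\mathbf t-\tfrac{\mathbf j}{n}),\qquad \Phi_n(\mathbf t)=\frac1{n^2}\sum_{\mathbf j\in\mathbb K_n^{\dagger *}}c_{\widehat{\mathbf j}}^{(n)}\phi_{\mathbf j}(\mathbf t),$$ and, for continuous complex-valued $f$ on $\Delta$, $$\mathcal L_nf(\mathbf t)=\sum_{\mathbf j\in\Upsilon_n^\circ}f(\tfrac{\mathbf j}{n})\,\frac{6}{n^2}\sum_{\mathbf k\in\Upsilon_n^{\dagger\circ}}\widehat\lambda_{\mathbf k}^{(n)}\,\mathsf{TS}_{\mathbf k}(\mathbf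 t)\,\overline{\mathsf{TS}_{\mathbf k}(\tfrac{\mathbf j}{n})},\qquad \mathcal L_n^*f(\mathbf t)=\sum_{\mathbf j\in\Upsilon_n}f(\tfrac{\mathbf j}{n})\,\frac{\lambda_{\mathbf j}^{(n)}}{n^2}\sum_{\mathbf k\in\Upsilon_n^{\dagger}}\widehat\lambda_{\mathbf k}^{(n)}\,\mathsf{TC}_{\mathbf k}(\mathbf t)\,\overline{\mathsf{TC}_{\mathbf k}(\tfrac{\mathbf j}{n})}.$$ Then there is an absolute constant $c>0$ such that for every positive integer $n\equiv 0\pmod 3$ the operator norms (Lebesgue constants) of $\mathcal I_n^*$ on $C(\Omega)$ and of $\mathcal L_n$ and $\mathcal L_n^*$ on $C(\Delta)$, with respect to the uniform norms on $\Omega$ and $\Delta$, satisfy $$\|\mathcal I_n^*\|_\infty\le c(\log n)^2,\qquad \|\mathcal L_n\|_\infty\le c(\log n)^2,\qquad \|\mathcal L_n^*\|_\infty\le c(\log n)^2 .$$ -/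

import Mathlib

namespace HexFourier

noncomputable section

/-! ### Homogeneous coordinates

A point of the plane `t₁ + t₂ + t₃ = 0` is a function `t : Fin 3 → ℝ` with zero coordinate sum;
the coordinates `t₁, t₂, t₃` are `t 0, t 1, t 2`. -/

/-- The closed regular hexagon: the intersection of the plane `t₁ + t₂ + t₃ = 0`
with the cube `[-1,1]³`. -/
def hexagon : Set (Fin 3 → ℝ) :=
  {t | t 0 + t 1 + t 2 = 0 ∧ ∀ i, -1 ≤ t i ∧ t i ≤ 1}

/-- The closed equilateral triangle `Δ`: `t₁ + t₂ + t₃ = 0` and `0 ≤ t₁, t₂, -t₃ ≤ 1`. -/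
def triangle : Set (Fin 3 → ℝ) :=
  {t | t 0 + t 1 + t 2 = 0 ∧ (0 ≤ t 0 ∧ t 0 ≤ 1) ∧ (0 ≤ t 1 ∧ t 1 ≤ 1) ∧
    (0 ≤ -t 2 ∧ -t 2 ≤ 1)}

/-- The point `j / n`. -/
def node (n : ℕ) (j : Fin 3 → ℤ) : Fin 3 → ℝ := fun i => (j i : ℝ) / (n : ℝ)

/-- The congruence `j ≡ 0 (mod 3)` of homogeneous coordinates: `j₁ ≡ j₂ ≡ j₃ (mod 3)`. -/
def Cong3 (j : Fin 3 → ℤ) : Prop := j 0 ≡ j 1 [ZMOD 3] ∧ j 1 ≡ j 2 [ZMOD 3]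

instance : DecidablePred Cong3 := fun j => by unfold Cong3; infer_instance

/-- The integer points of the plane `j₁ + j₂ + j₃ = 0` with all coordinates in `[-n, n]`. -/
def hexBox (n : ℕ) : Finset (Fin 3 → ℤ) :=
  (Fintype.piFinset fun _ => Finset.Icc (-(n : ℤ)) n).filter fun j => j 0 + j 1 + j 2 = 0

theorem mem_hexBox {n : ℕ} {j : Fin 3 → ℤ} :
    j ∈ hexBox n ↔ (∀ i, -(n : ℤ) ≤ j i ∧ j i ≤ n) ∧ j 0 + j 1 + j 2 = 0 := by
  simp [hexBox, Fintype.mem_piFinset]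

/-- The symmetric set `K_n^*` indexing the nodes `j / n` in the closed hexagon. -/
def KStar (n : ℕ) : Finset (Fin 3 → ℤ) := (hexBox n).filter Cong3

theorem mem_KStar {n : ℕ} {j : Fin 3 → ℤ} :
    j ∈ KStar n ↔
      ((∀ i, -(n : ℤ) ≤ j i ∧ j i ≤ n) ∧ j 0 + j 1 + j 2 = 0) ∧ Cong3 j := by
  simp [KStar, mem_hexBox]

/-- The symmetric set `K_n^{†*}` of frequencies: all `j ∈ ℤ³` with `j₁ + j₂ + j₃ = 0` and
`-n ≤ j₂ - j₁, j₁ - j₃, j₂ - j₃ ≤ n`  (see `mem_KDagStar`). -/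
def KDagStar (n : ℕ) : Finset (Fin 3 → ℤ) :=
  (hexBox n).filter fun j =>
    (-(n : ℤ) ≤ j 1 - j 0 ∧ j 1 - j 0 ≤ n) ∧ (-(n : ℤ) ≤ j 0 - j 2 ∧ j 0 - j 2 ≤ n) ∧
      (-(n : ℤ) ≤ j 1 - j 2 ∧ j 1 - j 2 ≤ n)

theorem mem_KDagStar {n : ℕ} {j : Fin 3 → ℤ} :
    j ∈ KDagStar n ↔ j 0 + j 1 + j 2 = 0 ∧
      (-(n : ℤ) ≤ j 1 - j 0 ∧ j 1 - j 0 ≤ n) ∧ (-(n : ℤ) ≤ j 0 - j 2 ∧ j 0 - j 2 ≤ n) ∧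
      (-(n : ℤ) ≤ j 1 - j 2 ∧ j 1 - j 2 ≤ n) := by
  simp only [KDagStar, Finset.mem_filter, mem_hexBox]
  constructor
  · rintro ⟨⟨_, h0⟩, h⟩
    exact ⟨h0, h⟩
  · rintro ⟨h0, h⟩
    refine ⟨⟨fun i => ?_, h0⟩, h⟩
    fin_cases i <;> simp <;> omega

/-- The set `Υ_n` indexing the nodes `j / n` in the triangle. -/
def Ups (n : ℕ) : Finset (Fin 3 → ℤ) :=
  (hexBox n).filter fun j => (0 ≤ j 0 ∧ 0 ≤ j 1 ∧ 0 ≤ -j 2) ∧ Cong3 j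

theorem mem_Ups {n : ℕ} {j : Fin 3 → ℤ} :
    j ∈ Ups n ↔ (j 0 + j 1 + j 2 = 0 ∧ (0 ≤ j 0 ∧ j 0 ≤ n) ∧ (0 ≤ j 1 ∧ j 1 ≤ n) ∧
      (0 ≤ -j 2 ∧ -j 2 ≤ n)) ∧ Cong3 j := by
  simp only [Ups, Finset.mem_filter, mem_hexBox, Fin.forall_fin_succ]
  simp
  constructor
  · rintro ⟨h1, h2, h3⟩
    exact ⟨by omega, h3⟩
  · rintro ⟨h1, h3⟩
    exact ⟨by omega, by omega, h3⟩

/-- The points of `Υ_n` in the interior of the triangle. -/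
def UpsInt (n : ℕ) : Finset (Fin 3 → ℤ) :=
  (Ups n).filter fun j => 0 < j 0 ∧ 0 < j 1 ∧ -j 2 < n

/-- The set `Υ_n^†` of frequencies, in a closed quadrilateral. -/
def UpsDag (n : ℕ) : Finset (Fin 3 → ℤ) :=
  (hexBox n).filter fun k =>
    (0 ≤ k 0 ∧ 0 ≤ k 1 ∧ 0 ≤ -k 2) ∧ k 1 - k 2 ≤ n ∧ k 0 - k 2 ≤ n

/-- The set `Υ_n^{†∘}` of the `k ∈ Υ_n^†` off the mirror lines `k₁ = 0` and `k₂ = 0`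
(on these two lines the generalized sine vanishes identically). -/
def UpsDagInt (n : ℕ) : Finset (Fin 3 → ℤ) :=
  (UpsDag n).filter fun k => 0 < k 0 ∧ 0 < k 1

/-- `k̂ = (k₃ - k₂, k₁ - k₃, k₂ - k₁)`. -/
def hat (k : Fin 3 → ℤ) : Fin 3 → ℤ := ![k 2 - k 1, k 0 - k 2, k 1 - k 0]

/-- The weight `c_j^{(n)}` of a point of the hexagon `|j₁|, |j₂|, |j₃| ≤ n`: it is `1` in the
interior, `1/2` on the edges without the corners (exactly one `|j_i|` equals `n`), and `1/3` at
the corners (two of the `|j_i|` equal `n`). -/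
def cWeight (n : ℕ) (j : Fin 3 → ℤ) : ℝ :=
  if (Finset.univ.filter fun i => |j i| = n).card = 0 then 1
  else if (Finset.univ.filter fun i => |j i| = n).card = 1 then 1 / 2
  else 1 / 3

/-- The weight `λ_j^{(n)}` of a point of `Υ_n`: `6` in the interior of the triangle, `1` at its
corners `(0,0,0)`, `(n,0,-n)`, `(0,n,-n)`, and `3` on the rest of its boundary. -/
def lamWeight (n : ℕ) (j : Fin 3 → ℤ) : ℝ :=
  if 0 < j 0 ∧ 0 < j 1 ∧ -j 2 < n then 6
  else if j = ![0, 0, 0] ∨ j = ![(n : ℤ), 0, -n] ∨ j = ![0, (n : ℤ), -n] then 1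
  else 3

/-- The exponential `φ_k(t) = exp ((2πi/3) k · t)`. -/
def phi (k : Fin 3 → ℤ) (t : Fin 3 → ℝ) : ℂ :=
  Complex.exp (2 * Real.pi * Complex.I / 3 * ((∑ i, (k i : ℝ) * t i : ℝ) : ℂ))

/-- The action `t ↦ tσ` of the reflection group `A₂`, which as a group is `S₃`: the three rotations
permute the coordinates cyclically, the three reflections are `t ↦ -(t₁,t₃,t₂)`, `-(t₂,t₁,t₃)`
and `-(t₃,t₂,t₁)`. -/
def act {R : Type*} [Ring R] (σ : Equiv.Perm (Fin 3)) (t : Fin 3 → R) : Fin 3 → R :=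
  fun i => (((Equiv.Perm.sign σ : ℤˣ) : ℤ) : R) * t (σ i)

/-- The projection `P⁺` onto functions invariant under `A₂`. -/
def projPlus (f : (Fin 3 → ℝ) → ℂ) (t : Fin 3 → ℝ) : ℂ :=
  1 / 6 * ∑ σ : Equiv.Perm (Fin 3), f (act σ t)

/-- The projection `P⁻` onto functions anti-invariant under `A₂`. -/
def projMinus (f : (Fin 3 → ℝ) → ℂ) (t : Fin 3 → ℝ) : ℂ :=
  1 / 6 * ∑ σ : Equiv.Perm (Fin 3), (((Equiv.Perm.sign σ : ℤˣ) : ℤ) : ℂ) * f (act σ t)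

/-- The generalized cosine. -/
def TC (k : Fin 3 → ℤ) (t : Fin 3 → ℝ) : ℂ := projPlus (phi k) t

/-- The generalized sine. -/
def TS (k : Fin 3 → ℤ) (t : Fin 3 → ℝ) : ℂ := 1 / Complex.I * projMinus (phi k) t

/-- The cardinality `|k A₂|` of the orbit of `k`. -/
def orbitCard (k : Fin 3 → ℤ) : ℕ :=
  (Finset.univ.image fun σ : Equiv.Perm (Fin 3) => act σ k).card

/-- The weight `λ̂_k^{(n)} = c_{k̂}^{(n)} |k A₂|`. -/
def lamHat (n : ℕ) (k : Fin 3 → ℤ) : ℝ := cWeight n (hat k) * orbitCard k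

/-- The kernel `Φ_n(t) = n⁻² ∑_{j ∈ K_n^{†*}} c_{ĵ}^{(n)} φ_j(t)`. -/
def Phi (n : ℕ) (t : Fin 3 → ℝ) : ℂ :=
  1 / (n : ℂ) ^ 2 * ∑ j ∈ KDagStar n, (cWeight n (hat j) : ℂ) * phi j t

/-- The fundamental function `ℓ°_{j,n}` of interpolation at the interior nodes. -/
def ellInt (n : ℕ) (j : Fin 3 → ℤ) (t : Fin 3 → ℝ) : ℂ :=
  6 / (n : ℂ) ^ 2 *
    ∑ k ∈ UpsDagInt n, (lamHat n k : ℂ) * (TS k t * starRingEnd ℂ (TS k (node n j)))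

/-- The fundamental function `ℓ_{j,n}` of interpolation at all nodes of the triangle. -/
def ell (n : ℕ) (j : Fin 3 → ℤ) (t : Fin 3 → ℝ) : ℂ :=
  (lamWeight n j : ℂ) / (n : ℂ) ^ 2 *
    ∑ k ∈ UpsDag n, (lamHat n k : ℂ) * (TC k t * starRingEnd ℂ (TC k (node n j)))

/-! ### The facts needed to bundle the operators -/

theorem isCompact_hexagon : IsCompact hexagon := by
  have hs : hexagon ⊆ Set.Icc (fun _ => (-1 : ℝ)) (fun _ => (1 : ℝ)) := fun t ht =>
    ⟨fun i => (ht.2 i).1, fun i => (ht.2 i).2⟩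
  refine isCompact_Icc.of_isClosed_subset ?_ hs
  have : hexagon = {t | t 0 + t 1 + t 2 = 0} ∩
      Set.Icc (fun _ => (-1 : ℝ)) (fun _ => (1 : ℝ)) := by
    ext t
    simp only [hexagon, Set.mem_ofPred_eq, Set.mem_inter_iff, Set.mem_Icc, Pi.le_def]
    exact and_congr_right fun _ => forall_and
  rw [this]
  exact (isClosed_eq (by fun_prop) continuous_const).inter isClosed_Icc

theorem triangle_subset_hexagon : triangle ⊆ hexagon := by
  rintro t ⟨h, h0, h1, h2⟩
  refine ⟨h, fun i => ?_⟩
  fin_cases i <;> simp <;> constructor <;> linarith [h0.1, h0.2, h1.1, h1.2, h2.1, h2.2]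

theorem isCompact_triangle : IsCompact triangle := by
  refine isCompact_hexagon.of_isClosed_subset ?_ triangle_subset_hexagon
  simp only [triangle, Set.ofPred_and]
  refine (isClosed_eq (by fun_prop) continuous_const).inter ?_
  refine ((isClosed_le ?_ ?_).inter (isClosed_le ?_ ?_)).inter
    (((isClosed_le ?_ ?_).inter (isClosed_le ?_ ?_)).inter
      ((isClosed_le ?_ ?_).inter (isClosed_le ?_ ?_))) <;> fun_prop

instance : CompactSpace hexagon := isCompact_iff_compactSpace.mp isCompact_hexagon

instance : CompactSpace triangle := isCompact_iff_compactSpace.mp isCompact_triangle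

theorem node_sum {n : ℕ} {j : Fin 3 → ℤ} (h : j 0 + j 1 + j 2 = 0) :
    node n j 0 + node n j 1 + node n j 2 = 0 := by
  have h' : (j 0 : ℝ) + j 1 + j 2 = 0 := by exact_mod_cast h
  simp only [node]
  rw [← add_div, ← add_div, h', zero_div]

theorem div_le_one_of_le (n : ℕ) {a : ℤ} (h : a ≤ n) : (a : ℝ) / (n : ℝ) ≤ 1 :=
  div_le_one_of_le₀ (by exact_mod_cast h) (Nat.cast_nonneg n)

theorem node_mem_hexagon {n : ℕ} {j : Fin 3 → ℤ} (hj : j ∈ KStar n) : node n j ∈ hexagon := by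
  obtain ⟨⟨hb, hs⟩, -⟩ := mem_KStar.mp hj
  refine ⟨node_sum hs, fun i => ⟨?_, div_le_one_of_le n (hb i).2⟩⟩
  have := div_le_one_of_le n (a := -j i) (by linarith [(hb i).1])
  rw [Int.cast_neg, neg_div] at this
  simp only [node]
  linarith

theorem node_mem_triangle {n : ℕ} {j : Fin 3 → ℤ} (hj : j ∈ Ups n) : node n j ∈ triangle := by
  obtain ⟨⟨hs, h0, h1, h2⟩, -⟩ := mem_Ups.mp hj
  have hn : (0 : ℝ) ≤ n := Nat.cast_nonneg n
  refine ⟨node_sum hs, ⟨div_nonneg (by exact_mod_cast h0.1) hn, div_le_one_of_le n h0.2⟩,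
    ⟨div_nonneg (by exact_mod_cast h1.1) hn, div_le_one_of_le n h1.2⟩, ?_⟩
  have e : -node n j 2 = ((-j 2 : ℤ) : ℝ) / n := by simp [node, neg_div]
  rw [e]
  exact ⟨div_nonneg (by exact_mod_cast h2.1) hn, div_le_one_of_le n h2.2⟩

@[fun_prop]
theorem continuous_phi (k : Fin 3 → ℤ) : Continuous (phi k) := by
  unfold phi
  fun_prop

@[fun_prop]
theorem continuous_act (σ : Equiv.Perm (Fin 3)) : Continuous (act (R := ℝ) σ) := by
  unfold act
  fun_prop

@[fun_prop]
theorem continuous_TC (k : Fin 3 → ℤ) : Continuous (TC k) := by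
  unfold TC projPlus
  fun_prop

@[fun_prop]
theorem continuous_TS (k : Fin 3 → ℤ) : Continuous (TS k) := by
  unfold TS projMinus
  fun_prop

@[fun_prop]
theorem continuous_Phi (n : ℕ) : Continuous (Phi n) := by
  unfold Phi
  fun_prop

@[fun_prop]
theorem continuous_ellInt (n : ℕ) (j : Fin 3 → ℤ) : Continuous (ellInt n j) := by
  unfold ellInt
  fun_prop

@[fun_prop]
theorem continuous_ell (n : ℕ) (j : Fin 3 → ℤ) : Continuous (ell n j) := by
  unfold ell
  fun_prop

/-! ### The operators

`C(X, ℂ)` carries the uniform norm and `→L` the corresponding operator norm. -/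

/-- The operator `I_n^*` on the continuous functions on the hexagon:
`I_n^* f (t) = ∑_{j ∈ K_n^*} f(j/n) Φ_n(t - j/n)`  (see `IStar_apply`). -/
def IStar (n : ℕ) : C(hexagon, ℂ) →L[ℂ] C(hexagon, ℂ) :=
  ∑ j : KStar n, (ContinuousMap.evalCLM ℂ (⟨node n j, node_mem_hexagon j.2⟩ : hexagon)).smulRight
    (⟨fun t : hexagon => Phi n ((t : Fin 3 → ℝ) - node n j), by fun_prop⟩ : C(hexagon, ℂ))

theorem IStar_apply (n : ℕ) (f : C(hexagon, ℂ)) (t : hexagon) :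
    IStar n f t = ∑ j : KStar n,
      f ⟨node n j, node_mem_hexagon j.2⟩ * Phi n ((t : Fin 3 → ℝ) - node n j) := by
  simp [IStar, ContinuousMap.sum_apply]

theorem UpsInt_sub {n : ℕ} {j : Fin 3 → ℤ} (h : j ∈ UpsInt n) : j ∈ Ups n :=
  (Finset.mem_filter.mp h).1

/-- The operator `L_n` on the continuous functions on the triangle:
`L_n f (t) = ∑_{j ∈ Υ_n^∘} f(j/n) ℓ°_{j,n}(t)`  (see `L_apply`). -/
def L (n : ℕ) : C(triangle, ℂ) →L[ℂ] C(triangle, ℂ) :=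
  ∑ j : UpsInt n,
    (ContinuousMap.evalCLM ℂ
      (⟨node n j, node_mem_triangle (UpsInt_sub j.2)⟩ : triangle)).smulRight
    (⟨fun t : triangle => ellInt n j (t : Fin 3 → ℝ), by fun_prop⟩ : C(triangle, ℂ))

theorem L_apply (n : ℕ) (f : C(triangle, ℂ)) (t : triangle) :
    L n f t = ∑ j : UpsInt n,
      f ⟨node n j, node_mem_triangle (UpsInt_sub j.2)⟩ * ellInt n j (t : Fin 3 → ℝ) := by
  simp [L, ContinuousMap.sum_apply]

/-- The operator `L_n^*` on the continuous functions on the triangle: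
`L_n^* f (t) = ∑_{j ∈ Υ_n} f(j/n) ℓ_{j,n}(t)`  (see `LStar_apply`). -/
def LStar (n : ℕ) : C(triangle, ℂ) →L[ℂ] C(triangle, ℂ) :=
  ∑ j : Ups n,
    (ContinuousMap.evalCLM ℂ (⟨node n j, node_mem_triangle j.2⟩ : triangle)).smulRight
    (⟨fun t : triangle => ell n j (t : Fin 3 → ℝ), by fun_prop⟩ : C(triangle, ℂ))

theorem LStar_apply (n : ℕ) (f : C(triangle, ℂ)) (t : triangle) :
    LStar n f t = ∑ j : Ups n,
      f ⟨node n j, node_mem_triangle j.2⟩ * ell n j (t : Fin 3 → ℝ) := by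
  simp [LStar, ContinuousMap.sum_apply]

end

end HexFourier

namespace HexFourier

noncomputable section

/-! ### One-dimensional kernels -/

/-! Each operator norm is at most the supremum over `t` of the sum of the absolute values of the
fundamental functions, so everything rests on bounding `∑ j, ‖Phi n (t - j/n)‖`.

In the coordinates `hat j` the frequencies of `Phi n` fill a hexagon, which is cut into three rhombi
with common vertex at the origin. Halving the weight on the sides of each rhombus reproduces the
weight `cWeight` except at the origin and the corners, an error bounded independently of `n`
(`sum_abs_cWeight_sub_rhombiWeight_le`). The frequencies in a rhombus are the pairs `(x, y)` with `3
∣ x + y`; averaging over cube roots of unity detects this congruence, and each rhombus sum becomes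
an average of three products of one-dimensional Dirichlet kernels (`sum_rhombus_eq`, `norm_Phi_le`).

Such a kernel is bounded by `n` and by the reciprocal distance to the integers. Over nodes spaced
`1/(3n)` its absolute values therefore add up to `O(n log n)` (`sum_Icc_norm_trapKernel_le`). Two
coordinates determine a node, so the product of two such sums, divided by `n²`, gives `O((log n)²)`
(`sum_norm_Phi_le`).

On the triangle the kernels are symmetrisations of `Phi n` under the reflection group
(`sum_UpsDag_TC`, `sum_UpsDagInt_TS`). The group preserves the hexagon nodes, so each of the 36
terms obeys the hexagon bound. -/

/-- The character `x ↦ exp (2πi x)`. -/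
def expChar (x : ℝ) : ℂ := Complex.exp ((2 * Real.pi * x : ℝ) * Complex.I)

theorem norm_expChar (x : ℝ) : ‖expChar x‖ = 1 := Complex.norm_exp_ofReal_mul_I _

theorem expChar_add (x y : ℝ) : expChar (x + y) = expChar x * expChar y := by
  rw [expChar, expChar, expChar, ← Complex.exp_add]
  push_cast
  ring_nf

theorem expChar_nat_mul (k : ℕ) (x : ℝ) : expChar (k * x) = expChar x ^ k := by
  rw [expChar, expChar, ← Complex.exp_nat_mul]
  push_cast
  ring_nf

theorem expChar_int (k : ℤ) : expChar k = 1 := by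
  rw [expChar, Complex.exp_eq_one_iff]
  exact ⟨k, by push_cast; ring⟩

theorem norm_expChar_sub_one (x : ℝ) : ‖expChar x - 1‖ = 2 * |Real.sin (Real.pi * x)| := by
  have h := Complex.norm_exp_I_mul_ofReal_sub_one (2 * Real.pi * x)
  rw [mul_comm Complex.I] at h
  rw [expChar, h, Real.norm_eq_abs, abs_mul, abs_two]
  ring_nf

/-- The weights of the trapezoidal rule on `{0, …, n}`. -/
def trapWeight (n x : ℕ) : ℝ :=
  1 - (if x = 0 then 1 / 2 else 0) - (if x = n then 1 / 2 else 0)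

/-- The modified Dirichlet kernel with frequencies `0, …, n`. -/
def trapKernel (n : ℕ) (a : ℝ) : ℂ :=
  ∑ x ∈ Finset.range (n + 1), (trapWeight n x : ℂ) * expChar (x * a)

theorem trapKernel_eq (n : ℕ) (a : ℝ) :
    trapKernel n a =
      ∑ x ∈ Finset.range (n + 1), expChar a ^ x - 1 / 2 - 1 / 2 * expChar a ^ n := by
  have h : ∀ x ∈ Finset.range (n + 1), (trapWeight n x : ℂ) * expChar (x * a) =
      expChar a ^ x - (if x = 0 then 1 / 2 else 0) -
        (if x = n then 1 / 2 * expChar a ^ n else 0) := by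
    intro x _
    rw [expChar_nat_mul, trapWeight]
    split_ifs with h0 h1 h1 <;> subst_vars <;> push_cast <;> ring
  rw [trapKernel, Finset.sum_congr rfl h, Finset.sum_sub_distrib, Finset.sum_sub_distrib]
  simp

theorem norm_trapKernel_le_geom (n : ℕ) (a : ℝ) :
    ‖trapKernel n a‖ ≤ ‖∑ x ∈ Finset.range (n + 1), expChar a ^ x‖ + 1 := by
  rw [trapKernel_eq]
  have h1 := norm_sub_le (∑ x ∈ Finset.range (n + 1), expChar a ^ x - 1 / 2)
    (1 / 2 * expChar a ^ n)
  have h2 := norm_sub_le (∑ x ∈ Finset.range (n + 1), expChar a ^ x) (1 / 2)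
  have h3 : ‖(1 / 2 : ℂ) * expChar a ^ n‖ = 1 / 2 := by simp [norm_expChar]
  have h4 : ‖(1 / 2 : ℂ)‖ = 1 / 2 := by simp
  linarith

theorem norm_trapKernel_le (n : ℕ) (a : ℝ) : ‖trapKernel n a‖ ≤ n + 2 := by
  have h : ‖∑ x ∈ Finset.range (n + 1), expChar a ^ x‖ ≤ n + 1 := by
    refine (norm_sum_le _ _).trans ?_
    simp [norm_expChar]
  linarith [norm_trapKernel_le_geom n a]

/-- Jordan's inequality on each half of the interval gives `2 * min a (1 - a)`. The weaker product
form is used because its reciprocal splits into partial fractions. -/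
theorem two_mul_mul_le_sin {a : ℝ} (h0 : 0 < a) (h1 : a < 1) :
    2 * (a * (1 - a)) ≤ Real.sin (Real.pi * a) := by
  have hpi := Real.pi_pos
  rcases le_total a (1 / 2) with h | h
  · have := Real.mul_le_sin (x := Real.pi * a) (by positivity) (by nlinarith)
    have e : 2 / Real.pi * (Real.pi * a) = 2 * a := by field_simp
    nlinarith
  · have := Real.mul_le_sin (x := Real.pi * (1 - a)) (by nlinarith) (by nlinarith)
    have e : 2 / Real.pi * (Real.pi * (1 - a)) = 2 * (1 - a) := by field_simp
    have e' : Real.sin (Real.pi * (1 - a)) = Real.sin (Real.pi * a) := by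
      rw [← Real.sin_pi_sub]; ring_nf
    nlinarith

theorem norm_trapKernel_le_inv (n : ℕ) {a : ℝ} (h0 : 0 < a) (h1 : a < 1) :
    ‖trapKernel n a‖ ≤ 1 + 1 / 2 * (1 / a + 1 / (1 - a)) := by
  have hb : 0 < 1 - a := by linarith
  have hs := two_mul_mul_le_sin h0 h1
  have hp : 0 < 2 * (a * (1 - a)) := by positivity
  have hsp : 0 < Real.sin (Real.pi * a) := hp.trans_le hs
  have hn := norm_expChar_sub_one a
  rw [abs_of_pos hsp] at hn
  have hne : expChar a ≠ 1 := by
    intro h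
    rw [h, sub_self, norm_zero] at hn
    linarith
  have hg : ‖∑ x ∈ Finset.range (n + 1), expChar a ^ x‖ ≤ 1 / (2 * (a * (1 - a))) := by
    rw [geom_sum_eq hne, norm_div, hn]
    have : ‖expChar a ^ (n + 1) - 1‖ ≤ 2 := by
      refine (norm_sub_le _ _).trans ?_
      simp [norm_expChar]
      norm_num
    calc _ ≤ 2 / (2 * Real.sin (Real.pi * a)) := by gcongr
      _ = 1 / Real.sin (Real.pi * a) := by field_simp
      _ ≤ _ := by gcongr
  have e : 1 / (2 * (a * (1 - a))) = 1 / 2 * (1 / a + 1 / (1 - a)) := by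
    field_simp
    ring
  linarith [norm_trapKernel_le_geom n a]

theorem trapKernel_add_int (n : ℕ) (a : ℝ) (k : ℤ) : trapKernel n (a + k) = trapKernel n a := by
  rw [trapKernel_eq, trapKernel_eq, expChar_add, expChar_int, mul_one]

/-- The points run over one period with spacing `1/(K+2)`. The two with `m = 0, 1` may lie
arbitrarily close to an integer and get the trivial bound `n + 2`; the other `K` lie at least `m -
1` steps from `0` and `K + 2 - m` steps from `1`, which yields two harmonic sums. -/
theorem sum_range_norm_trapKernel_le (n K : ℕ) (hK : 0 < K) {θ : ℝ} (h0 : 0 ≤ θ) (h1 : θ < 1) :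
    ∑ m ∈ Finset.range (K + 2), ‖trapKernel n ((m - θ) / ((K + 2 : ℕ) : ℝ))‖ ≤
      2 * (n + 2) + K + (K + 2) * (1 + Real.log K) := by
  have hH : ∑ m ∈ Finset.range K, (1 : ℝ) / (m + 1) ≤ 1 + Real.log K := by
    have := harmonic_le_one_add_log K
    rw [harmonic] at this
    push_cast at this
    simpa only [one_div] using this
  have hR : ∑ m ∈ Finset.range K, (1 : ℝ) / (K - m) = ∑ m ∈ Finset.range K, (1 : ℝ) / (m + 1) := by
    rw [← Finset.sum_range_reflect]
    refine Finset.sum_congr rfl fun m hm => ?_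
    rw [Finset.mem_range] at hm
    congr 1
    rw [Nat.sub_sub, Nat.cast_sub (by omega)]
    push_cast
    ring
  have hM : ∀ m ∈ Finset.range K,
      ‖trapKernel n (((m + 1 + 1 : ℕ) - θ) / ((K + 2 : ℕ) : ℝ))‖ ≤
        1 + (K + 2) / 2 * (1 / (m + 1) + 1 / (K - m)) := by
    intro m hm
    have hm' : (m : ℝ) + 1 ≤ K := by exact_mod_cast Finset.mem_range.mp hm
    have hm0 : (0 : ℝ) ≤ m := Nat.cast_nonneg m
    have hK2 : (0 : ℝ) < K + 2 := by positivity
    push_cast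
    refine (norm_trapKernel_le_inv n (div_pos (by linarith) hK2)
      ((div_lt_one hK2).mpr (by linarith))).trans ?_
    have e : 1 - ((m : ℝ) + 1 + 1 - θ) / (K + 2) = (K - m + θ) / (K + 2) := by
      field_simp
      ring
    rw [e, one_div_div, one_div_div]
    have i1 : ((K : ℝ) + 2) / (m + 1 + 1 - θ) ≤ (K + 2) / (m + 1) := by
      gcongr
      linarith
    have i2 : ((K : ℝ) + 2) / (K - m + θ) ≤ (K + 2) / (K - m) := by
      apply div_le_div_of_nonneg_left <;> linarith
    have e2 : ((K : ℝ) + 2) / 2 * (1 / (m + 1) + 1 / (K - m)) =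
        1 / 2 * ((K + 2) / (m + 1) + (K + 2) / (K - m)) := by ring
    rw [e2]
    linarith
  rw [Finset.sum_range_succ', Finset.sum_range_succ']
  have hs := Finset.sum_le_sum hM
  rw [Finset.sum_add_distrib, ← Finset.mul_sum, Finset.sum_add_distrib, hR] at hs
  simp only [Finset.sum_const, Finset.card_range, nsmul_eq_mul, mul_one] at hs
  have b0 := norm_trapKernel_le n (((0 : ℕ) - θ) / ((K + 2 : ℕ) : ℝ))
  have b1 := norm_trapKernel_le n (((0 + 1 : ℕ) - θ) / ((K + 2 : ℕ) : ℝ))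
  have hm : ((K : ℝ) + 2) / 2 * (∑ m ∈ Finset.range K, (1 : ℝ) / (m + 1) +
      ∑ m ∈ Finset.range K, (1 : ℝ) / (m + 1)) ≤ (K + 2) * (1 + Real.log K) := by
    rw [← two_mul, ← mul_assoc, div_mul_cancel₀ _ two_ne_zero]
    gcongr
  linarith

theorem one_le_log_nat {n : ℕ} (hn : 3 ≤ n) : 1 ≤ Real.log n := by
  rw [Real.le_log_iff_exp_le (by positivity)]
  have : (3 : ℝ) ≤ n := by exact_mod_cast hn
  linarith [Real.exp_one_lt_d9]

/-- By periodicity the arguments may be reduced modulo 1, where they become distinct points of a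
shifted grid of `3n` points; the sum is then enlarged to the whole grid. -/
theorem sum_Icc_norm_trapKernel_le {n : ℕ} (hn : 3 ≤ n) (τ : ℝ) :
    ∑ m ∈ Finset.Icc (-(n : ℤ)) n, ‖trapKernel n ((m : ℝ) / (3 * n) - τ)‖ ≤
      18 * n * Real.log n := by
  have hn' : (3 : ℝ) ≤ n := by exact_mod_cast hn
  obtain ⟨K, hK⟩ : ∃ K, 3 * n = K + 2 := ⟨3 * n - 2, by omega⟩
  have hKr : (3 : ℝ) * n = K + 2 := by exact_mod_cast hK
  have hKr' : (3 : ℝ) * n = (K + 2 : ℕ) := by exact_mod_cast hK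
  set m₀ : ℤ := ⌊3 * n * τ⌋ with hm₀
  set θ : ℝ := Int.fract (3 * n * τ) with hθ
  have hτ : τ = (m₀ + θ) / (3 * n) := by
    rw [hm₀, hθ, Int.floor_add_fract]
    field_simp
  have hval : ∀ m : ℤ, ‖trapKernel n ((m : ℝ) / (3 * n) - τ)‖ =
      ‖trapKernel n (((((m - m₀) % (3 * n)).toNat : ℕ) - θ) / ((K + 2 : ℕ) : ℝ))‖ := by
    intro m
    have hc : ((((m - m₀) % (3 * n)).toNat : ℕ) : ℝ) = (((m - m₀) % (3 * n) : ℤ) : ℝ) := by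
      have : ((((m - m₀) % (3 * n)).toNat : ℕ) : ℤ) = (m - m₀) % (3 * n) :=
        Int.toNat_of_nonneg (Int.emod_nonneg _ (by omega))
      exact_mod_cast this
    have hd : (((m - m₀) % (3 * n) : ℤ) : ℝ) = m - m₀ - 3 * n * (((m - m₀) / (3 * n) : ℤ) : ℝ) := by
      rw [Int.emod_def]
      push_cast
      ring
    rw [hc, hd, ← hKr', ← trapKernel_add_int n _ (-((m - m₀) / (3 * n)))]
    congr 2
    push_cast
    rw [hτ]
    field_simp
    ring
  -- Two indices differ by at most `2n < 3n`, so no residue is repeated.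
  have hinj : Set.InjOn (fun m : ℤ => ((m - m₀) % (3 * n)).toNat)
      (Finset.Icc (-(n : ℤ)) n : Finset ℤ) := by
    intro a ha b hb hab
    simp only [Finset.coe_Icc, Set.mem_Icc] at ha hb
    have h1 := Int.emod_nonneg (a - m₀) (b := 3 * (n : ℤ)) (by omega)
    have h2 := Int.emod_nonneg (b - m₀) (b := 3 * (n : ℤ)) (by omega)
    have hab' : (a - m₀) % (3 * n) = (b - m₀) % (3 * n) := by
      simp only at hab
      omega
    obtain ⟨q, hq⟩ := Int.ModEq.dvd (n := 3 * (n : ℤ)) hab'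
    have : q = 0 := by
      have u1 : q < 1 := by by_contra h; nlinarith
      have u2 : -1 < q := by by_contra h; nlinarith
      omega
    subst this
    omega
  calc ∑ m ∈ Finset.Icc (-(n : ℤ)) n, ‖trapKernel n ((m : ℝ) / (3 * n) - τ)‖
      = ∑ x ∈ (Finset.Icc (-(n : ℤ)) n).image (fun m : ℤ => ((m - m₀) % (3 * n)).toNat),
        ‖trapKernel n (((x : ℕ) - θ) / ((K + 2 : ℕ) : ℝ))‖ := by
        rw [Finset.sum_image hinj]
        exact Finset.sum_congr rfl fun m _ => hval m
    _ ≤ ∑ x ∈ Finset.range (K + 2), ‖trapKernel n (((x : ℕ) - θ) / ((K + 2 : ℕ) : ℝ))‖ := by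
        refine Finset.sum_le_sum_of_subset_of_nonneg ?_ fun _ _ _ => norm_nonneg _
        intro x hx
        obtain ⟨m, -, rfl⟩ := Finset.mem_image.mp hx
        have h1 := Int.emod_lt_of_pos (m - m₀) (b := 3 * (n : ℤ)) (by omega)
        have h2 := Int.emod_nonneg (m - m₀) (b := 3 * (n : ℤ)) (by omega)
        rw [Finset.mem_range]
        omega
    _ ≤ 2 * (n + 2) + K + (K + 2) * (1 + Real.log K) :=
        sum_range_norm_trapKernel_le n K (by omega) (Int.fract_nonneg _) (Int.fract_lt_one _)
    _ ≤ 18 * n * Real.log n := by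
        have hl := one_le_log_nat hn
        have hKpos : (0 : ℝ) < K := by linarith
        -- Here `K < 3n ≤ n²`.
        have hlog : Real.log K ≤ 2 * Real.log n := by
          have := Real.log_le_log hKpos (show (K : ℝ) ≤ n * n by nlinarith)
          rw [Real.log_mul (by positivity) (by positivity)] at this
          linarith
        have : ((K : ℝ) + 2) * (1 + Real.log K) ≤ 3 * n * (1 + 2 * Real.log n) := by
          rw [← hKr]
          gcongr
        nlinarith

/-! ### Splitting the hexagon of frequencies into three rhombi -/

/-- The trapezoidal weights on `{0, …, n}`, extended by zero to the integers. -/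
def trapWeightInt (n : ℕ) (p : ℤ) : ℝ := if 0 ≤ p ∧ p ≤ n then trapWeight n p.toNat else 0

theorem trapWeightInt_cases {n : ℕ} (hn : 0 < n) {m : ℤ} (h₁ : -(n : ℤ) ≤ m) (h₂ : m ≤ n) :
    (m = -n ∧ trapWeightInt n m = 0 ∧ trapWeightInt n (-m) = 1 / 2 ∧ |m| = n) ∨
    ((-(n : ℤ) < m ∧ m < 0) ∧ trapWeightInt n m = 0 ∧ trapWeightInt n (-m) = 1 ∧ |m| ≠ n) ∨
    (m = 0 ∧ trapWeightInt n m = 1 / 2 ∧ trapWeightInt n (-m) = 1 / 2 ∧ |m| ≠ n) ∨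
    ((0 < m ∧ m < n) ∧ trapWeightInt n m = 1 ∧ trapWeightInt n (-m) = 0 ∧ |m| ≠ n) ∨
    (m = n ∧ trapWeightInt n m = 1 / 2 ∧ trapWeightInt n (-m) = 0 ∧ |m| = n) := by
  have hneg : ∀ p : ℤ, p < 0 → trapWeightInt n p = 0 := fun p hp =>
    if_neg (by omega)
  have hzero : trapWeightInt n 0 = 1 / 2 := by
    simp [trapWeightInt, trapWeight, hn.ne]
    norm_num
  have htop : trapWeightInt n n = 1 / 2 := by
    simp [trapWeightInt, trapWeight, hn.ne']
    norm_num
  have hmid : ∀ p : ℤ, 0 < p → p < n → trapWeightInt n p = 1 := by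
    intro p hp hpn
    rw [trapWeightInt, if_pos ⟨hp.le, hpn.le⟩, trapWeight, if_neg (by omega), if_neg (by omega)]
    norm_num
  rcases h₁.lt_or_eq with h | h
  · rcases lt_trichotomy m 0 with h0 | h0 | h0
    · exact Or.inr (Or.inl ⟨⟨h, h0⟩, hneg _ h0, hmid _ (by omega) (by omega),
        by rw [abs_of_neg h0]; omega⟩)
    · subst h0
      exact Or.inr (Or.inr (Or.inl ⟨rfl, hzero, by rw [neg_zero, hzero], by simp; omega⟩))
    · rcases h₂.lt_or_eq with h' | h'
      · exact Or.inr (Or.inr (Or.inr (Or.inl ⟨⟨h0, h'⟩, hmid _ h0 h', hneg _ (by omega),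
          by rw [abs_of_pos h0]; omega⟩)))
      · exact Or.inr (Or.inr (Or.inr (Or.inr ⟨h', by rw [h', htop], hneg _ (by omega),
          by rw [abs_of_pos h0]; omega⟩)))
  · refine Or.inl ⟨h.symm, hneg _ (by omega), ?_, by rw [← h]; simp⟩
    rw [← h, neg_neg, htop]

theorem card_filter_abs_eq (n : ℕ) (m : Fin 3 → ℤ) :
    (Finset.univ.filter fun i => |m i| = n).card =
      (if |m 0| = n then 1 else 0) + (if |m 1| = n then 1 else 0) +
        (if |m 2| = n then 1 else 0) := by
  rw [Finset.card_filter, Fin.sum_univ_three]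

/-- The sum of the weights of the three rhombi into which the hexagon splits. -/
def rhombiWeight (n : ℕ) (m : Fin 3 → ℤ) : ℝ :=
  ∑ i, trapWeightInt n (-m i) * trapWeightInt n (m (i + 2))

/-- Inside a rhombus both weights are 1, on a side shared by two rhombi the halves add up to 1, and
on an outer edge both are 1/2. They differ only at the origin (1 against 3/4) and at the corners
(1/3 against 1/4 or 1/2, alternately). -/
theorem abs_cWeight_sub_rhombiWeight_le {n : ℕ} (hn : 0 < n) {m : Fin 3 → ℤ}
    (hs : m 0 + m 1 + m 2 = 0) (hm : ∀ i, -(n : ℤ) ≤ m i ∧ m i ≤ n) :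
    |cWeight n m - rhombiWeight n m| ≤
      if ∀ i, m i ∈ ({-(n : ℤ), 0, (n : ℤ)} : Finset ℤ) then 1 else 0 := by
  have e : rhombiWeight n m = trapWeightInt n (-m 0) * trapWeightInt n (m 2) +
      trapWeightInt n (-m 1) * trapWeightInt n (m 0) +
      trapWeightInt n (-m 2) * trapWeightInt n (m 1) := by
    rw [rhombiWeight, Fin.sum_univ_three]
    rfl
  rw [cWeight, card_filter_abs_eq, e]
  simp only [Fin.forall_fin_succ, Finset.mem_insert, Finset.mem_singleton]
  -- Each coordinate is `-n`, negative, zero, positive or `n`; of the 125 patterns, `omega` discards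
  -- those incompatible with zero sum.
  rcases trapWeightInt_cases hn (hm 0).1 (hm 0).2 with
    ⟨h0, a0, b0, c0⟩ | ⟨h0, a0, b0, c0⟩ | ⟨h0, a0, b0, c0⟩ | ⟨h0, a0, b0, c0⟩ | ⟨h0, a0, b0, c0⟩ <;>
  rcases trapWeightInt_cases hn (hm 1).1 (hm 1).2 with
    ⟨h1, a1, b1, c1⟩ | ⟨h1, a1, b1, c1⟩ | ⟨h1, a1, b1, c1⟩ | ⟨h1, a1, b1, c1⟩ | ⟨h1, a1, b1, c1⟩ <;>
  rcases trapWeightInt_cases hn (hm 2).1 (hm 2).2 with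
    ⟨h2, a2, b2, c2⟩ | ⟨h2, a2, b2, c2⟩ | ⟨h2, a2, b2, c2⟩ | ⟨h2, a2, b2, c2⟩ | ⟨h2, a2, b2, c2⟩ <;>
  first
  | (exfalso; omega)
  | (rw [a0, a1, a2, b0, b1, b2]
     simp only [c0, c1, c2, if_true, if_false]
     norm_num
     try (split_ifs <;> norm_num <;> simp_all))

theorem hat_sum (j : Fin 3 → ℤ) : hat j 0 + hat j 1 + hat j 2 = 0 := by
  simp [hat]

theorem hat_bounds {n : ℕ} {j : Fin 3 → ℤ} (hj : j ∈ KDagStar n) (i : Fin 3) :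
    -(n : ℤ) ≤ hat j i ∧ hat j i ≤ n := by
  obtain ⟨-, h⟩ := mem_KDagStar.mp hj
  fin_cases i <;> simp [hat] <;> omega

theorem sum_abs_cWeight_sub_rhombiWeight_le {n : ℕ} (hn : 0 < n) :
    ∑ j ∈ KDagStar n, |cWeight n (hat j) - rhombiWeight n (hat j)| ≤ 9 := by
  set T : Finset ℤ := {-(n : ℤ), 0, (n : ℤ)} with hT
  calc _ ≤ ∑ j ∈ KDagStar n, if ∀ i, hat j i ∈ T then (1 : ℝ) else 0 :=
        Finset.sum_le_sum fun j hj =>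
          abs_cWeight_sub_rhombiWeight_le hn (hat_sum j) (hat_bounds hj)
    _ = (((KDagStar n).filter fun j => ∀ i, hat j i ∈ T).card : ℝ) := by
        rw [Finset.sum_boole]
    -- Two coordinates of `hat j` determine `j`, so at most `3 * 3` frequencies are exceptional.
    _ ≤ ((T ×ˢ T).card : ℝ) := by
        refine Nat.cast_le.mpr
          (Finset.card_le_card_of_injOn (fun j => (hat j 0, hat j 1)) ?_ ?_)
        · intro j hj
          have := (Finset.mem_filter.mp hj).2
          exact Finset.mem_product.mpr ⟨this 0, this 1⟩
        · intro j hj k hk hjk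
          have h1 := (mem_KDagStar.mp (Finset.mem_filter.mp hj).1).1
          have h2 := (mem_KDagStar.mp (Finset.mem_filter.mp hk).1).1
          simp [hat] at hjk
          funext i
          fin_cases i <;> simp <;> omega
    _ ≤ 9 := by
        rw [Finset.card_product]
        have : T.card ≤ 3 := Finset.card_le_three
        have : T.card * T.card ≤ 9 := by nlinarith
        exact_mod_cast this

/-! ### Rhombus sums as products of one-dimensional kernels -/

theorem phi_eq_expChar (i : Fin 3) {j : Fin 3 → ℤ} {s : Fin 3 → ℝ} (hj : j 0 + j 1 + j 2 = 0)
    (hs : s 0 + s 1 + s 2 = 0) :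
    phi j s = expChar ((-hat j i : ℤ) * (-s (i + 2) / 3)) *
      expChar ((hat j (i + 2) : ℤ) * (-s i / 3)) := by
  have hj' : (j 2 : ℝ) = -j 0 - j 1 := by
    have : j 2 = -j 0 - j 1 := by omega
    rw [this]
    push_cast
    ring
  have hs' : s 2 = -s 0 - s 1 := by linarith
  have h : (∑ k, (j k : ℝ) * s k) =
      3 * ((-hat j i : ℤ) * (-s (i + 2) / 3) + (hat j (i + 2) : ℤ) * (-s i / 3)) := by
    rw [Fin.sum_univ_three]
    fin_cases i <;> simp [hat, hj', hs'] <;> ring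
  rw [← expChar_add, phi, h, expChar]
  congr 1
  push_cast
  ring

theorem sum_range_three_expChar (z : ℕ) :
    ∑ r ∈ Finset.range 3, expChar (z * (r / 3)) = if 3 ∣ z then 3 else 0 := by
  have e : ∀ r ∈ Finset.range 3, expChar ((z : ℝ) * ((r : ℕ) / 3)) = expChar (z / 3) ^ r := by
    intro r _
    rw [← expChar_nat_mul]
    ring_nf
  rw [Finset.sum_congr rfl e]
  split_ifs with h
  · obtain ⟨q, rfl⟩ := h
    have : expChar (((3 * q : ℕ) : ℝ) / 3) = 1 := by
      have := expChar_int q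
      push_cast at this ⊢
      rwa [mul_div_cancel_left₀ _ three_ne_zero]
    rw [this]
    simp
  · have hne : expChar ((z : ℝ) / 3) ≠ 1 := by
      intro h1
      rw [expChar, Complex.exp_eq_one_iff] at h1
      obtain ⟨k, hk⟩ := h1
      have hpi := Complex.two_pi_I_ne_zero
      have h2 : (2 * Real.pi * Complex.I : ℂ) * ((z : ℂ) / 3) = 2 * Real.pi * Complex.I * k := by
        push_cast at hk
        linear_combination hk
      have h3 : (z : ℂ) = 3 * k := by
        have := mul_left_cancel₀ hpi h2
        field_simp at this
        linear_combination this
      have h4 : (z : ℤ) = 3 * k := by exact_mod_cast h3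
      omega
    have h3 : expChar ((z : ℝ) / 3) ^ 3 = 1 := by
      rw [← expChar_nat_mul]
      have := expChar_int z
      push_cast at this ⊢
      rwa [mul_div_cancel₀ _ (three_ne_zero : (3 : ℝ) ≠ 0)]
    rw [geom_sum_eq hne, h3]
    simp

theorem hat_dvd {j : Fin 3 → ℤ} (hj : j 0 + j 1 + j 2 = 0) (i : Fin 3) :
    (3 : ℤ) ∣ -hat j i + hat j (i + 2) := by
  fin_cases i <;> simp [hat] <;> omega

theorem hat_injective {j k : Fin 3 → ℤ} (hj : j 0 + j 1 + j 2 = 0) (hk : k 0 + k 1 + k 2 = 0)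
    (i : Fin 3) (h₁ : hat j i = hat k i) (h₂ : hat j (i + 2) = hat k (i + 2)) : j = k := by
  funext l
  fin_cases i <;> fin_cases l <;> simp [hat] at h₁ h₂ ⊢ <;> omega

/-- Converse of `hat_dvd`: divisibility by 3 is the only constraint on the two rhombus coordinates.
Their sum is three times one coordinate of `j`, so the quotient `q` gives that coordinate and the
others follow. -/
theorem exists_hat_eq {n : ℕ} (i : Fin 3) {x y : ℕ} (hx : x ≤ n) (hy : y ≤ n) (h : 3 ∣ x + y) :
    ∃ j ∈ KDagStar n, -hat j i = x ∧ hat j (i + 2) = y := by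
  obtain ⟨q, hq⟩ := h
  fin_cases i
  · exact ⟨![(q : ℤ) - y, q, y - 2 * q], mem_KDagStar.mpr (by simp; omega), by simp [hat]; omega⟩
  · exact ⟨![y - 2 * (q : ℤ), q - y, q], mem_KDagStar.mpr (by simp; omega), by simp [hat]; omega⟩
  · exact ⟨![(q : ℤ), y - 2 * q, q - y], mem_KDagStar.mpr (by simp; omega), by simp [hat]; omega⟩

theorem sum_rhombus_eq (n : ℕ) (i : Fin 3) {s : Fin 3 → ℝ} (hs : s 0 + s 1 + s 2 = 0) :
    ∑ j ∈ KDagStar n,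
        ((trapWeightInt n (-hat j i) * trapWeightInt n (hat j (i + 2)) : ℝ) : ℂ) * phi j s =
      1 / 3 * ∑ r ∈ Finset.range 3,
        trapKernel n (r / 3 - s (i + 2) / 3) * trapKernel n (r / 3 - s i / 3) := by
  set P : Finset (ℕ × ℕ) := Finset.range (n + 1) ×ˢ Finset.range (n + 1) with hP
  set a := -s (i + 2) / 3 with ha
  set b := -s i / 3 with hb
  have hr : ∀ r ∈ Finset.range 3,
      trapKernel n ((r : ℕ) / 3 - s (i + 2) / 3) * trapKernel n ((r : ℕ) / 3 - s i / 3) =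
      ∑ p ∈ P, ((trapWeight n p.1 : ℂ) * trapWeight n p.2 * (expChar (p.1 * a) *
        expChar (p.2 * b))) * expChar ((p.1 + p.2 : ℕ) * ((r : ℕ) / 3)) := by
    intro r _
    rw [trapKernel, trapKernel, Finset.sum_mul_sum, ← Finset.sum_product']
    refine Finset.sum_congr rfl fun p _ => ?_
    have e1 : (p.1 : ℝ) * (r / 3 - s (i + 2) / 3) = p.1 * a + p.1 * (r / 3) := by rw [ha]; ring
    have e2 : (p.2 : ℝ) * (r / 3 - s i / 3) = p.2 * b + p.2 * (r / 3) := by rw [hb]; ring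
    have e3 : ((p.1 + p.2 : ℕ) : ℝ) * (r / 3) = p.1 * (r / 3) + p.2 * (r / 3) := by
      push_cast; ring
    rw [e1, e2, e3, expChar_add, expChar_add, expChar_add]
    ring
  rw [Finset.sum_congr rfl hr, Finset.sum_comm]
  have hp : ∀ p ∈ P, ∑ r ∈ Finset.range 3, ((trapWeight n p.1 : ℂ) * trapWeight n p.2 *
        (expChar (p.1 * a) * expChar (p.2 * b))) * expChar ((p.1 + p.2 : ℕ) * ((r : ℕ) / 3)) =
      3 * if 3 ∣ p.1 + p.2 then (trapWeight n p.1 : ℂ) * trapWeight n p.2 *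
        (expChar (p.1 * a) * expChar (p.2 * b)) else 0 := by
    intro p _
    rw [← Finset.mul_sum, sum_range_three_expChar]
    split_ifs <;> ring
  rw [Finset.sum_congr rfl hp, ← Finset.mul_sum, ← mul_assoc, ← Finset.sum_filter]
  norm_num
  -- The extended weights vanish off the rhombus, so the left side reduces to the frequencies in it,
  -- which are then matched with the pairs satisfying `3 ∣ x + y`.
  have hQ : ∀ j ∈ KDagStar n,
      (trapWeightInt n (-hat j i) : ℂ) * trapWeightInt n (hat j (i + 2)) * phi j s ≠ 0 →
      (0 ≤ -hat j i ∧ -hat j i ≤ n) ∧ (0 ≤ hat j (i + 2) ∧ hat j (i + 2) ≤ n) := by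
    intro j _ h
    constructor <;> by_contra h'
    · have h0 : trapWeightInt n (-hat j i) = 0 := if_neg h'
      exact h (by simp [h0])
    · have h0 : trapWeightInt n (hat j (i + 2)) = 0 := if_neg h'
      exact h (by simp [h0])
  rw [← Finset.sum_filter_of_ne hQ]
  refine Finset.sum_bij (fun j _ => ((-hat j i).toNat, (hat j (i + 2)).toNat)) ?_ ?_ ?_ ?_
  · intro j hj
    obtain ⟨hj, h1, h2⟩ := Finset.mem_filter.mp hj
    have hd := hat_dvd (mem_KDagStar.mp hj).1 i
    simp only [hP, Finset.mem_filter, Finset.mem_product, Finset.mem_range]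
    omega
  · intro j hj k hk hjk
    obtain ⟨hj, h1, h2⟩ := Finset.mem_filter.mp hj
    obtain ⟨hk, h3, h4⟩ := Finset.mem_filter.mp hk
    rw [Prod.mk.injEq] at hjk
    exact hat_injective (mem_KDagStar.mp hj).1 (mem_KDagStar.mp hk).1 i (by omega) (by omega)
  · intro p hp
    simp only [hP, Finset.mem_filter, Finset.mem_product, Finset.mem_range] at hp
    obtain ⟨j, hj, h1, h2⟩ := exists_hat_eq (n := n) i (x := p.1) (y := p.2)
      (by omega) (by omega) hp.2
    refine ⟨j, Finset.mem_filter.mpr ⟨hj, by omega, by omega⟩, ?_⟩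
    ext <;> simp only <;> omega
  · intro j hj
    obtain ⟨hj, h1, h2⟩ := Finset.mem_filter.mp hj
    have c1 : (((-hat j i).toNat : ℕ) : ℝ) = ((-hat j i : ℤ) : ℝ) := by
      exact_mod_cast Int.toNat_of_nonneg h1.1
    have c2 : (((hat j (i + 2)).toNat : ℕ) : ℝ) = ((hat j (i + 2) : ℤ) : ℝ) := by
      exact_mod_cast Int.toNat_of_nonneg h2.1
    rw [phi_eq_expChar i (mem_KDagStar.mp hj).1 hs, trapWeightInt, trapWeightInt, if_pos h1,
      if_pos h2, c1, c2]

/-- Absolute values of the one-dimensional kernels bound the two-dimensional one. -/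
theorem norm_Phi_le {n : ℕ} (hn : 0 < n) {s : Fin 3 → ℝ} (hs : s 0 + s 1 + s 2 = 0) :
    (n : ℝ) ^ 2 * ‖Phi n s‖ ≤ 9 + ∑ i : Fin 3, 1 / 3 * ∑ r ∈ Finset.range 3,
      ‖trapKernel n (r / 3 - s (i + 2) / 3)‖ * ‖trapKernel n (r / 3 - s i / 3)‖ := by
  have hn0 : (n : ℂ) ≠ 0 := by exact_mod_cast hn.ne'
  have e : (n : ℂ) ^ 2 * Phi n s =
      ∑ j ∈ KDagStar n, ((cWeight n (hat j) - rhombiWeight n (hat j) : ℝ) : ℂ) * phi j s +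
      ∑ i : Fin 3, 1 / 3 * ∑ r ∈ Finset.range 3,
        trapKernel n (r / 3 - s (i + 2) / 3) * trapKernel n (r / 3 - s i / 3) := by
    rw [Finset.sum_congr rfl fun i _ => (sum_rhombus_eq n i hs).symm, Finset.sum_comm,
      ← Finset.sum_add_distrib, Phi, ← mul_assoc, mul_one_div_cancel (pow_ne_zero 2 hn0), one_mul]
    refine Finset.sum_congr rfl fun j _ => ?_
    rw [← Finset.sum_mul, ← add_mul, rhombiWeight]
    push_cast
    ring
  have hnorm : (n : ℝ) ^ 2 * ‖Phi n s‖ = ‖(n : ℂ) ^ 2 * Phi n s‖ := by simp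
  rw [hnorm, e]
  refine (norm_add_le _ _).trans (add_le_add ?_ ?_)
  · refine (norm_sum_le _ _).trans ((Finset.sum_le_sum fun j _ => ?_).trans
      (sum_abs_cWeight_sub_rhombiWeight_le hn))
    have : ‖phi j s‖ = 1 := by
      have h : phi j s = expChar ((∑ i, (j i : ℝ) * s i) / 3) := by
        rw [phi, expChar]
        push_cast
        ring_nf
      rw [h, norm_expChar]
    rw [norm_mul, this, mul_one, Complex.norm_real, Real.norm_eq_abs]
  · refine (norm_sum_le _ _).trans (Finset.sum_le_sum fun i _ => ?_)
    rw [norm_mul]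
    have h3 : ‖(1 / 3 : ℂ)‖ = 1 / 3 := by simp
    rw [h3]
    gcongr
    refine (norm_sum_le _ _).trans_eq (Finset.sum_congr rfl fun r _ => norm_mul _ _)

/-! ### Summation over the nodes -/

/-- Two coordinates determine a node, so the sum over nodes is part of the sum over the full square,
which factors. -/
theorem sum_KStar_mul_le (n : ℕ) {a b : Fin 3} (hab : a ≠ b) {g h : ℤ → ℝ} (hg : ∀ m, 0 ≤ g m)
    (hh : ∀ m, 0 ≤ h m) :
    ∑ j ∈ KStar n, g (j a) * h (j b) ≤
      (∑ m ∈ Finset.Icc (-(n : ℤ)) n, g m) * ∑ m ∈ Finset.Icc (-(n : ℤ)) n, h m := by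
  have hinj : Set.InjOn (fun j : Fin 3 → ℤ => (j a, j b)) (KStar n : Finset (Fin 3 → ℤ)) := by
    intro j hj k hk hjk
    have h1 := (mem_KStar.mp hj).1.2
    have h2 := (mem_KStar.mp hk).1.2
    rw [Prod.mk.injEq] at hjk
    funext i
    fin_cases a <;> fin_cases b <;> fin_cases i <;> simp at hab hjk ⊢ <;> omega
  rw [Finset.sum_mul_sum, ← Finset.sum_product',
    ← Finset.sum_image (f := fun p : ℤ × ℤ => g p.1 * h p.2) hinj]
  refine Finset.sum_le_sum_of_subset_of_nonneg ?_ fun p _ _ => mul_nonneg (hg _) (hh _)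
  intro p hp
  obtain ⟨j, hj, rfl⟩ := Finset.mem_image.mp hp
  have := (mem_KStar.mp hj).1.1
  simp only [Finset.mem_product, Finset.mem_Icc]
  exact ⟨this a, this b⟩

theorem sum_norm_Phi_le {n : ℕ} (hn : 3 ≤ n) {t : Fin 3 → ℝ} (ht : t 0 + t 1 + t 2 = 0) :
    ∑ j ∈ KStar n, ‖Phi n (t - node n j)‖ ≤ 1053 * Real.log n ^ 2 := by
  have hn' : (3 : ℝ) ≤ n := by exact_mod_cast hn
  have hl := one_le_log_nat hn
  have hcard : ((KStar n).card : ℝ) ≤ 9 * (n : ℝ) ^ 2 := by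
    have := sum_KStar_mul_le n (a := 0) (b := 1) (by decide) (g := fun _ => 1) (h := fun _ => 1)
      (fun _ => zero_le_one) fun _ => zero_le_one
    simp only [mul_one, Finset.sum_const, nsmul_eq_mul, Int.card_Icc] at this
    have h2 : (((n : ℤ) + 1 - -n).toNat : ℝ) = 2 * n + 1 := by
      have : ((n : ℤ) + 1 - -n).toNat = 2 * n + 1 := by omega
      rw [this]
      push_cast
      ring
    rw [h2] at this
    nlinarith
  have hprod : ∀ (i : Fin 3) (r : ℕ), ∑ j ∈ KStar n,
      ‖trapKernel n (r / 3 - (t - node n j) (i + 2) / 3)‖ *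
        ‖trapKernel n (r / 3 - (t - node n j) i / 3)‖ ≤ (18 * n * Real.log n) ^ 2 := by
    intro i r
    have e : ∀ (k : Fin 3) (j : Fin 3 → ℤ), (r : ℝ) / 3 - (t - node n j) k / 3 =
        (j k : ℝ) / (3 * n) - (t k / 3 - r / 3) := by
      intro k j
      simp only [Pi.sub_apply, node]
      field_simp
      ring
    simp only [e]
    refine (sum_KStar_mul_le n (a := i + 2) (b := i) (by fin_cases i <;> decide)
      (g := fun m => ‖trapKernel n ((m : ℝ) / (3 * n) - (t (i + 2) / 3 - r / 3))‖)
      (h := fun m => ‖trapKernel n ((m : ℝ) / (3 * n) - (t i / 3 - r / 3))‖)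
      (fun _ => norm_nonneg _) fun _ => norm_nonneg _).trans ?_
    rw [sq]
    exact mul_le_mul (sum_Icc_norm_trapKernel_le hn _) (sum_Icc_norm_trapKernel_le hn _)
      (Finset.sum_nonneg fun _ _ => norm_nonneg _) (by positivity)
  have hmain : (n : ℝ) ^ 2 * ∑ j ∈ KStar n, ‖Phi n (t - node n j)‖ ≤
      9 * (KStar n).card + 3 * (18 * n * Real.log n) ^ 2 := by
    rw [Finset.mul_sum]
    refine (Finset.sum_le_sum fun j hj => norm_Phi_le (by omega) (s := t - node n j) ?_).trans ?_
    · have := node_sum (n := n) (mem_KStar.mp hj).1.2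
      simp only [Pi.sub_apply]
      linarith
    · rw [Finset.sum_add_distrib, Finset.sum_comm]
      refine add_le_add (by simp [mul_comm]) ?_
      have hi : ∀ i : Fin 3, ∑ j ∈ KStar n, 1 / 3 * ∑ r ∈ Finset.range 3,
          ‖trapKernel n (r / 3 - (t - node n j) (i + 2) / 3)‖ *
            ‖trapKernel n (r / 3 - (t - node n j) i / 3)‖ ≤ (18 * n * Real.log n) ^ 2 := by
        intro i
        rw [← Finset.mul_sum, Finset.sum_comm]
        have := Finset.sum_le_sum fun r (_ : r ∈ Finset.range 3) => hprod i r
        simp only [Finset.sum_const, Finset.card_range, nsmul_eq_mul] at this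
        push_cast at this
        linarith
      have := Finset.sum_le_sum fun i (_ : i ∈ Finset.univ) => hi i
      simpa using this
  have hn2 : (0 : ℝ) < (n : ℝ) ^ 2 := by positivity
  refine le_of_mul_le_mul_left (hmain.trans ?_) hn2
  -- The constant is `1053 = 9 * 9 + 3 * 18 ^ 2`; the first term is absorbed since `log n ≥ 1`.
  have : (n : ℝ) ^ 2 * 1 ≤ (n : ℝ) ^ 2 * Real.log n ^ 2 := by
    gcongr
    nlinarith
  nlinarith

/-! ### The reflection group -/

theorem perm_fin_three_cases (σ : Equiv.Perm (Fin 3)) :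
    (σ 0 = 0 ∧ σ 1 = 1 ∧ σ 2 = 2 ∧ Equiv.Perm.sign σ = 1) ∨
    (σ 0 = 1 ∧ σ 1 = 2 ∧ σ 2 = 0 ∧ Equiv.Perm.sign σ = 1) ∨
    (σ 0 = 2 ∧ σ 1 = 0 ∧ σ 2 = 1 ∧ Equiv.Perm.sign σ = 1) ∨
    (σ 0 = 0 ∧ σ 1 = 2 ∧ σ 2 = 1 ∧ Equiv.Perm.sign σ = -1) ∨
    (σ 0 = 1 ∧ σ 1 = 0 ∧ σ 2 = 2 ∧ Equiv.Perm.sign σ = -1) ∨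
    (σ 0 = 2 ∧ σ 1 = 1 ∧ σ 2 = 0 ∧ Equiv.Perm.sign σ = -1) := by
  revert σ
  decide

theorem act_cases {R : Type*} [Ring R] (σ : Equiv.Perm (Fin 3)) (t : Fin 3 → R) :
    (act σ t 0 = t 0 ∧ act σ t 1 = t 1 ∧ act σ t 2 = t 2) ∨
    (act σ t 0 = t 1 ∧ act σ t 1 = t 2 ∧ act σ t 2 = t 0) ∨
    (act σ t 0 = t 2 ∧ act σ t 1 = t 0 ∧ act σ t 2 = t 1) ∨
    (act σ t 0 = -t 0 ∧ act σ t 1 = -t 2 ∧ act σ t 2 = -t 1) ∨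
    (act σ t 0 = -t 1 ∧ act σ t 1 = -t 0 ∧ act σ t 2 = -t 2) ∨
    (act σ t 0 = -t 2 ∧ act σ t 1 = -t 1 ∧ act σ t 2 = -t 0) := by
  rcases perm_fin_three_cases σ with ⟨h0, h1, h2, h⟩ | ⟨h0, h1, h2, h⟩ | ⟨h0, h1, h2, h⟩ |
    ⟨h0, h1, h2, h⟩ | ⟨h0, h1, h2, h⟩ | ⟨h0, h1, h2, h⟩ <;> simp [act, h0, h1, h2, h]

theorem act_act {R : Type*} [Ring R] (σ τ : Equiv.Perm (Fin 3)) (t : Fin 3 → R) :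
    act σ (act τ t) = act (τ * σ) t := by
  funext i
  simp only [act, Equiv.Perm.sign_mul, Equiv.Perm.mul_apply, ← mul_assoc, Units.val_mul,
    Int.cast_mul]
  congr 1
  exact Int.cast_commute _ _

theorem act_one {R : Type*} [Ring R] (t : Fin 3 → R) : act 1 t = t := by
  funext i
  simp [act]

theorem act_sum {R : Type*} [CommRing R] (σ : Equiv.Perm (Fin 3)) {t : Fin 3 → R}
    (ht : t 0 + t 1 + t 2 = 0) : act σ t 0 + act σ t 1 + act σ t 2 = 0 := by
  have e : ∑ i, act σ t i = 0 := by
    simp only [act]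
    rw [← Finset.mul_sum, Equiv.sum_comp σ t, Fin.sum_univ_three, ht, mul_zero]
  rwa [Fin.sum_univ_three] at e

theorem sign_cast_mul_self {R : Type*} [Ring R] (σ : Equiv.Perm (Fin 3)) :
    (((Equiv.Perm.sign σ : ℤˣ) : ℤ) : R) * ((Equiv.Perm.sign σ : ℤˣ) : ℤ) = 1 := by
  rw [← Int.cast_mul, ← Units.val_mul, Int.units_mul_self]
  simp

theorem phi_act (σ : Equiv.Perm (Fin 3)) (k : Fin 3 → ℤ) (t : Fin 3 → ℝ) :
    phi (act σ k) t = phi k (act σ⁻¹ t) := by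
  have h : ∑ i, ((act σ k i : ℤ) : ℝ) * t i = ∑ i, (k i : ℝ) * act σ⁻¹ t i := by
    rw [← Equiv.sum_comp σ fun i => (k i : ℝ) * act σ⁻¹ t i]
    refine Finset.sum_congr rfl fun i _ => ?_
    simp only [act, Equiv.Perm.sign_inv, ← Equiv.Perm.mul_apply, inv_mul_cancel,
      Equiv.Perm.one_apply]
    push_cast
    ring
  rw [phi, phi, h]

theorem TC_act (σ : Equiv.Perm (Fin 3)) (k : Fin 3 → ℤ) (t : Fin 3 → ℝ) :
    TC (act σ k) t = TC k t := by
  simp only [TC, projPlus, phi_act, act_act]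
  exact congrArg (1 / 6 * ·) (Equiv.sum_comp (Equiv.mulRight σ⁻¹) fun τ => phi k (act τ t))

theorem TS_act (σ : Equiv.Perm (Fin 3)) (k : Fin 3 → ℤ) (t : Fin 3 → ℝ) :
    TS (act σ k) t = (((Equiv.Perm.sign σ : ℤˣ) : ℤ) : ℂ) * TS k t := by
  have h : ∑ τ : Equiv.Perm (Fin 3), (((Equiv.Perm.sign τ : ℤˣ) : ℤ) : ℂ) * phi (act σ k) (act τ t)
      = (((Equiv.Perm.sign σ : ℤˣ) : ℤ) : ℂ) * ∑ τ : Equiv.Perm (Fin 3),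
        (((Equiv.Perm.sign τ : ℤˣ) : ℤ) : ℂ) * phi k (act τ t) := by
    rw [Finset.mul_sum, ← Equiv.sum_comp (Equiv.mulRight σ⁻¹) fun τ =>
      (((Equiv.Perm.sign σ : ℤˣ) : ℤ) : ℂ) * ((((Equiv.Perm.sign τ : ℤˣ) : ℤ) : ℂ) *
        phi k (act τ t))]
    refine Finset.sum_congr rfl fun τ _ => ?_
    simp only [phi_act, act_act, Equiv.coe_mulRight, Equiv.Perm.sign_mul, Equiv.Perm.sign_inv,
      Units.val_mul, Int.cast_mul]
    linear_combination (-(((Equiv.Perm.sign τ : ℤˣ) : ℤ) : ℂ) * phi k (act (τ * σ⁻¹) t)) *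
      sign_cast_mul_self (R := ℂ) σ
  rw [TS, TS, projMinus, projMinus, h]
  ring

/-- Such a `k` is fixed by a reflection, under which the generalized sine changes sign. -/
theorem TS_eq_zero {k : Fin 3 → ℤ} (hk : k 0 + k 1 + k 2 = 0) (h : k 0 = 0 ∨ k 1 = 0)
    (t : Fin 3 → ℝ) : TS k t = 0 := by
  have key : ∀ σ : Equiv.Perm (Fin 3), Equiv.Perm.sign σ = -1 → act σ k = k → TS k t = 0 := by
    intro σ hσ hk
    have := TS_act σ k t
    rw [hk, hσ] at this
    simp at this
    linear_combination this / 2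
  rcases h with h | h
  · refine key (Equiv.swap 1 2) (by decide) ?_
    funext i
    fin_cases i <;> simp [act, Equiv.swap_apply_def, h] <;> omega
  · refine key (Equiv.swap 0 2) (by decide) ?_
    funext i
    fin_cases i <;> simp [act, Equiv.swap_apply_def, h] <;> omega

/-- An odd permutation reverses the differences in `hat`, and the sign in `act` undoes this; the
group thus merely permutes the coordinates of `hat k`. -/
theorem cWeight_hat_act (n : ℕ) (σ : Equiv.Perm (Fin 3)) (k : Fin 3 → ℤ) :
    cWeight n (hat (act σ k)) = cWeight n (hat k) := by
  have h : hat (act σ k) = fun i => hat k (σ i) := by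
    funext i
    rcases perm_fin_three_cases σ with ⟨h0, h1, h2, h⟩ | ⟨h0, h1, h2, h⟩ | ⟨h0, h1, h2, h⟩ |
      ⟨h0, h1, h2, h⟩ | ⟨h0, h1, h2, h⟩ | ⟨h0, h1, h2, h⟩ <;> fin_cases i <;>
      simp [hat, act, h0, h1, h2, h] <;> ring
  have hc : (Finset.univ.filter fun i => |hat (act σ k) i| = n).card =
      (Finset.univ.filter fun i => |hat k i| = n).card := by
    rw [Finset.card_filter, Finset.card_filter, h,
      Equiv.sum_comp σ fun i => if |hat k i| = n then 1 else 0]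
  rw [cWeight, cWeight, hc]

/-! ### Orbit sums over the fundamental cone and symmetrised kernels -/

theorem mem_UpsDag {n : ℕ} {k : Fin 3 → ℤ} :
    k ∈ UpsDag n ↔ k 0 + k 1 + k 2 = 0 ∧ 0 ≤ k 0 ∧ 0 ≤ k 1 ∧ k 1 - k 2 ≤ n ∧ k 0 - k 2 ≤ n := by
  simp only [UpsDag, Finset.mem_filter, mem_hexBox, Fin.forall_fin_succ]
  simp
  omega

/-- The cone `k₁, k₂ ≥ 0` is a fundamental domain of the reflection group. -/
theorem KDagStar_eq_biUnion (n : ℕ) :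
    KDagStar n = (UpsDag n).biUnion fun k => Finset.univ.image fun σ => act σ k := by
  ext k
  simp only [Finset.mem_biUnion, Finset.mem_image, Finset.mem_univ, true_and]
  constructor
  · intro hk
    obtain ⟨hs, h⟩ := mem_KDagStar.mp hk
    have key : ∀ σ : Equiv.Perm (Fin 3), act σ k ∈ UpsDag n →
        ∃ a ∈ UpsDag n, ∃ σ, act σ a = k := fun σ hσ =>
      ⟨_, hσ, σ⁻¹, by rw [act_act, mul_inv_cancel, act_one]⟩
    -- The six closed chambers cover the plane, since two of three coordinates share a weak sign;
    -- each chamber is carried to the fundamental cone by one group element.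
    obtain h | h | h | h | h | h : (0 ≤ k 0 ∧ 0 ≤ k 1) ∨ (0 ≤ k 1 ∧ 0 ≤ k 2) ∨
        (0 ≤ k 2 ∧ 0 ≤ k 0) ∨ (k 0 ≤ 0 ∧ k 2 ≤ 0) ∨ (k 1 ≤ 0 ∧ k 0 ≤ 0) ∨
        (k 2 ≤ 0 ∧ k 1 ≤ 0) := by omega
    · exact key 1 (by rw [act_one, mem_UpsDag]; omega)
    · obtain ⟨σ, h0, h1, h2, hσ⟩ : ∃ σ : Equiv.Perm (Fin 3),
        σ 0 = 1 ∧ σ 1 = 2 ∧ σ 2 = 0 ∧ Equiv.Perm.sign σ = 1 := by decide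
      exact key σ (by rw [mem_UpsDag]; simp [act, h0, h1, h2, hσ]; omega)
    · obtain ⟨σ, h0, h1, h2, hσ⟩ : ∃ σ : Equiv.Perm (Fin 3),
        σ 0 = 2 ∧ σ 1 = 0 ∧ σ 2 = 1 ∧ Equiv.Perm.sign σ = 1 := by decide
      exact key σ (by rw [mem_UpsDag]; simp [act, h0, h1, h2, hσ]; omega)
    · obtain ⟨σ, h0, h1, h2, hσ⟩ : ∃ σ : Equiv.Perm (Fin 3),
        σ 0 = 0 ∧ σ 1 = 2 ∧ σ 2 = 1 ∧ Equiv.Perm.sign σ = -1 := by decide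
      exact key σ (by rw [mem_UpsDag]; simp [act, h0, h1, h2, hσ]; omega)
    · obtain ⟨σ, h0, h1, h2, hσ⟩ : ∃ σ : Equiv.Perm (Fin 3),
        σ 0 = 1 ∧ σ 1 = 0 ∧ σ 2 = 2 ∧ Equiv.Perm.sign σ = -1 := by decide
      exact key σ (by rw [mem_UpsDag]; simp [act, h0, h1, h2, hσ]; omega)
    · obtain ⟨σ, h0, h1, h2, hσ⟩ : ∃ σ : Equiv.Perm (Fin 3),
        σ 0 = 2 ∧ σ 1 = 1 ∧ σ 2 = 0 ∧ Equiv.Perm.sign σ = -1 := by decide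
      exact key σ (by rw [mem_UpsDag]; simp [act, h0, h1, h2, hσ]; omega)
  · rintro ⟨a, ha, σ, rfl⟩
    have ha := mem_UpsDag.mp ha
    rw [mem_KDagStar]
    rcases act_cases σ a with h | h | h | h | h | h <;> omega

theorem pairwiseDisjoint_orbit (n : ℕ) :
    Set.PairwiseDisjoint (UpsDag n : Set (Fin 3 → ℤ))
      fun k => Finset.univ.image fun σ => act σ k := by
  intro k hk l hl hkl
  rw [Function.onFun, Finset.disjoint_left]
  intro m hm hm'
  simp only [Finset.mem_image, Finset.mem_univ, true_and] at hm hm'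
  obtain ⟨σ, rfl⟩ := hm
  obtain ⟨τ, hτ⟩ := hm'
  have e : act (τ * σ⁻¹) l = k := by
    rw [← act_act, hτ, act_act, mul_inv_cancel, act_one]
  apply hkl
  have hk := mem_UpsDag.mp hk
  have hl := mem_UpsDag.mp hl
  rw [← e] at hk ⊢
  funext i
  rcases act_cases (τ * σ⁻¹) l with h | h | h | h | h | h <;> fin_cases i <;> simp <;> omega

/-- The factor `orbitCard` in `lamHat` is exactly what unfolds a sum over the cone into a sum over
all frequencies, points on the mirror lines included. -/
theorem sum_UpsDag_orbitCard (n : ℕ) {g : (Fin 3 → ℤ) → ℂ} (hg : ∀ σ k, g (act σ k) = g k) :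
    ∑ k ∈ UpsDag n, (orbitCard k : ℂ) * g k = ∑ k ∈ KDagStar n, g k := by
  rw [KDagStar_eq_biUnion, Finset.sum_biUnion (pairwiseDisjoint_orbit n)]
  refine Finset.sum_congr rfl fun k _ => ?_
  rw [Finset.sum_congr (g := fun _ => g k) rfl, Finset.sum_const, nsmul_eq_mul, orbitCard]
  intro l hl
  obtain ⟨σ, -, rfl⟩ := Finset.mem_image.mp hl
  exact hg σ k

theorem phi_mul_conj_phi (k : Fin 3 → ℤ) (s t : Fin 3 → ℝ) :
    phi k t * starRingEnd ℂ (phi k s) = phi k (t - s) := by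
  rw [phi, phi, phi, ← Complex.exp_conj, ← Complex.exp_add]
  congr 1
  simp only [map_mul, map_div₀, Complex.conj_I, Complex.conj_ofReal, Pi.sub_apply, mul_sub,
    Finset.sum_sub_distrib, Complex.conj_ofNat]
  push_cast
  ring

theorem act_node (n : ℕ) (σ : Equiv.Perm (Fin 3)) (j : Fin 3 → ℤ) :
    act σ (node n j) = node n (act σ j) := by
  funext i
  simp only [act, node]
  push_cast
  ring

theorem act_mem_KStar {n : ℕ} (σ : Equiv.Perm (Fin 3)) {j : Fin 3 → ℤ} (hj : j ∈ KStar n) :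
    act σ j ∈ KStar n := by
  have h := mem_KStar.mp hj
  rw [mem_KStar]
  simp only [Fin.forall_fin_succ, Cong3, Int.ModEq] at h ⊢
  simp at h ⊢
  rcases act_cases σ j with h' | h' | h' | h' | h' | h' <;> omega

theorem act_injective (σ : Equiv.Perm (Fin 3)) : Function.Injective (act (R := ℤ) σ) := by
  intro j k h
  have := congrArg (act σ⁻¹) h
  rwa [act_act, act_act, mul_inv_cancel, act_one, act_one] at this

/-- The kernel of the triangle in terms of the kernel of the hexagon; `χ` is the trivial or the
sign character. -/
theorem sum_KDagStar_eq {n : ℕ} (hn : 0 < n) (χ : Equiv.Perm (Fin 3) → ℂ) (s t : Fin 3 → ℝ) :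
    ∑ k ∈ KDagStar n, (cWeight n (hat k) : ℂ) *
        ((∑ σ, χ σ * phi k (act σ t)) * starRingEnd ℂ (∑ τ, χ τ * phi k (act τ s))) =
      n ^ 2 * ∑ σ, ∑ τ, χ σ * starRingEnd ℂ (χ τ) * Phi n (act σ t - act τ s) := by
  have hn0 : (n : ℂ) ≠ 0 := by exact_mod_cast hn.ne'
  have e : ∀ σ τ : Equiv.Perm (Fin 3),
      (n : ℂ) ^ 2 * (χ σ * starRingEnd ℂ (χ τ) * Phi n (act σ t - act τ s)) =
        ∑ k ∈ KDagStar n, (cWeight n (hat k) : ℂ) *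
          (χ σ * phi k (act σ t) * starRingEnd ℂ (χ τ * phi k (act τ s))) := by
    intro σ τ
    simp only [Phi, ← phi_mul_conj_phi, map_mul, Finset.mul_sum]
    refine Finset.sum_congr rfl fun k _ => ?_
    field_simp
  simp only [map_sum, Finset.sum_mul_sum]
  simp only [Finset.mul_sum, e]
  rw [Finset.sum_comm]
  exact Finset.sum_congr rfl fun σ _ => Finset.sum_comm

theorem sum_UpsDag_TC {n : ℕ} (hn : 0 < n) (s t : Fin 3 → ℝ) :
    ∑ k ∈ UpsDag n, (lamHat n k : ℂ) * (TC k t * starRingEnd ℂ (TC k s)) =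
      n ^ 2 / 36 * ∑ σ, ∑ τ, Phi n (act σ t - act τ s) := by
  have h := sum_UpsDag_orbitCard n
    (g := fun k => (cWeight n (hat k) : ℂ) * (TC k t * starRingEnd ℂ (TC k s)))
    (fun σ k => by simp only [TC_act, cWeight_hat_act])
  have h' := sum_KDagStar_eq hn (fun _ => 1) s t
  simp only [one_mul, map_one] at h'
  calc _ = _ := Finset.sum_congr rfl fun k _ => by rw [lamHat]; push_cast; ring
    _ = _ := h
    -- Each of the two projections contributes a factor `1 / 6`.
    _ = 1 / 36 * ∑ k ∈ KDagStar n, (cWeight n (hat k) : ℂ) *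
        ((∑ σ, phi k (act σ t)) * starRingEnd ℂ (∑ τ, phi k (act τ s))) := by
      rw [Finset.mul_sum]
      refine Finset.sum_congr rfl fun k _ => ?_
      rw [TC, TC, projPlus, projPlus, map_mul]
      simp only [map_div₀, map_one, map_ofNat]
      ring
    _ = _ := by rw [h']; ring

theorem sum_UpsDagInt_TS {n : ℕ} (hn : 0 < n) (s t : Fin 3 → ℝ) :
    ∑ k ∈ UpsDagInt n, (lamHat n k : ℂ) * (TS k t * starRingEnd ℂ (TS k s)) =
      n ^ 2 / 36 * ∑ σ : Equiv.Perm (Fin 3), ∑ τ : Equiv.Perm (Fin 3),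
        (((Equiv.Perm.sign σ : ℤˣ) : ℤ) : ℂ) * (((Equiv.Perm.sign τ : ℤˣ) : ℤ) : ℂ) *
          Phi n (act σ t - act τ s) := by
  have h := sum_UpsDag_orbitCard n
    (g := fun k => (cWeight n (hat k) : ℂ) * (TS k t * starRingEnd ℂ (TS k s)))
    (fun σ k => by
      simp only [TS_act, cWeight_hat_act, map_mul, map_intCast]
      linear_combination (cWeight n (hat k) * (TS k t * starRingEnd ℂ (TS k s))) *
        sign_cast_mul_self (R := ℂ) σ)
  have h' := sum_KDagStar_eq hn (fun σ => (((Equiv.Perm.sign σ : ℤˣ) : ℤ) : ℂ)) s t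
  simp only [map_intCast] at h'
  calc _ = ∑ k ∈ UpsDag n, (lamHat n k : ℂ) * (TS k t * starRingEnd ℂ (TS k s)) := by
        -- The mirror lines can be added for free, because the generalized sine vanishes there.
        refine Finset.sum_subset (Finset.filter_subset _ _) fun k hk hk' => ?_
        have hk1 := mem_UpsDag.mp hk
        have hk2 : ¬(0 < k 0 ∧ 0 < k 1) := fun h => hk' (Finset.mem_filter.mpr ⟨hk, h⟩)
        rw [TS_eq_zero hk1.1 (by omega), zero_mul, mul_zero]
    _ = _ := Finset.sum_congr rfl fun k _ => by rw [lamHat]; push_cast; ring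
    _ = _ := h
    _ = 1 / 36 * ∑ k ∈ KDagStar n, (cWeight n (hat k) : ℂ) *
        ((∑ σ : Equiv.Perm (Fin 3), (((Equiv.Perm.sign σ : ℤˣ) : ℤ) : ℂ) * phi k (act σ t)) *
          starRingEnd ℂ (∑ τ : Equiv.Perm (Fin 3),
            (((Equiv.Perm.sign τ : ℤˣ) : ℤ) : ℂ) * phi k (act τ s))) := by
      rw [Finset.mul_sum]
      refine Finset.sum_congr rfl fun k _ => ?_
      rw [TS, TS, projMinus, projMinus, map_mul, map_mul]
      simp only [map_div₀, map_one, map_ofNat, Complex.conj_I]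
      field_simp
      rw [Complex.I_sq]
      ring
    _ = _ := by rw [h']; ring

/-! ### Operator norms -/

/-- For fixed `σ` and `τ`, `act τ` maps the nodes injectively into the hexagon nodes, so the bound
of `sum_norm_Phi_le` at the point `act σ t` applies to each of the 36 pairs. -/
theorem sum_norm_Phi_act_le {n : ℕ} (hn : 3 ≤ n) {t : Fin 3 → ℝ} (ht : t 0 + t 1 + t 2 = 0)
    {S : Finset (Fin 3 → ℤ)} (hS : S ⊆ KStar n) :
    ∑ j ∈ S, ∑ σ, ∑ τ, ‖Phi n (act σ t - act τ (node n j))‖ ≤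
      36 * (1053 * Real.log n ^ 2) := by
  rw [Finset.sum_comm]
  simp only [Finset.sum_comm (s := S)]
  have h : ∀ σ τ : Equiv.Perm (Fin 3), ∑ j ∈ S, ‖Phi n (act σ t - act τ (node n j))‖ ≤
      1053 * Real.log n ^ 2 := by
    intro σ τ
    refine le_trans ?_ (sum_norm_Phi_le hn (act_sum σ ht))
    simp only [act_node]
    rw [← Finset.sum_image (f := fun j => ‖Phi n (act σ t - node n j)‖)
      (act_injective τ).injOn]
    refine Finset.sum_le_sum_of_subset_of_nonneg ?_ fun _ _ _ => norm_nonneg _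
    intro j hj
    obtain ⟨k, hk, rfl⟩ := Finset.mem_image.mp hj
    exact act_mem_KStar τ (hS hk)
  refine (Finset.sum_le_sum fun σ _ => Finset.sum_le_sum fun τ _ => h σ τ).trans_eq ?_
  simp [Fintype.card_perm, Nat.factorial]
  ring

theorem Ups_subset_KStar (n : ℕ) : Ups n ⊆ KStar n := by
  intro j hj
  have h := mem_Ups.mp hj
  rw [mem_KStar]
  simp only [Fin.forall_fin_succ]
  simp
  exact ⟨by omega, h.2⟩

theorem norm_ellInt_le {n : ℕ} (hn : 0 < n) (j : Fin 3 → ℤ) (t : Fin 3 → ℝ) :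
    ‖ellInt n j t‖ ≤ 1 / 6 * ∑ σ, ∑ τ, ‖Phi n (act σ t - act τ (node n j))‖ := by
  have hn0 : (n : ℂ) ≠ 0 := by exact_mod_cast hn.ne'
  have hsign : ∀ σ : Equiv.Perm (Fin 3), ‖(((Equiv.Perm.sign σ : ℤˣ) : ℤ) : ℂ)‖ = 1 := by
    intro σ
    rcases Int.units_eq_one_or (Equiv.Perm.sign σ) with h | h <;> simp [h]
  rw [ellInt, sum_UpsDagInt_TS hn, ← mul_assoc]
  have e : (6 : ℂ) / n ^ 2 * (n ^ 2 / 36) = ((1 / 6 : ℝ) : ℂ) := by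
    push_cast
    field_simp
    norm_num
  rw [e, norm_mul, Complex.norm_real, Real.norm_of_nonneg (by norm_num)]
  gcongr
  refine (norm_sum_le _ _).trans (Finset.sum_le_sum fun σ _ => ?_)
  refine (norm_sum_le _ _).trans (Finset.sum_le_sum fun τ _ => ?_)
  rw [norm_mul, norm_mul, hsign, hsign, one_mul, one_mul]

theorem norm_ell_le {n : ℕ} (hn : 0 < n) (j : Fin 3 → ℤ) (t : Fin 3 → ℝ) :
    ‖ell n j t‖ ≤ 1 / 6 * ∑ σ, ∑ τ, ‖Phi n (act σ t - act τ (node n j))‖ := by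
  have hn0 : (n : ℂ) ≠ 0 := by exact_mod_cast hn.ne'
  have hlam : 0 ≤ lamWeight n j ∧ lamWeight n j ≤ 6 := by
    rw [lamWeight]
    split_ifs <;> norm_num
  rw [ell, sum_UpsDag_TC hn, ← mul_assoc]
  have e : (lamWeight n j : ℂ) / n ^ 2 * (n ^ 2 / 36) = ((lamWeight n j / 36 : ℝ) : ℂ) := by
    push_cast
    field_simp
  rw [e, norm_mul, Complex.norm_real, Real.norm_of_nonneg (by linarith)]
  refine mul_le_mul (by linarith) ?_ (norm_nonneg _) (by norm_num)
  refine (norm_sum_le _ _).trans (Finset.sum_le_sum fun σ _ => ?_)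
  exact norm_sum_le _ _

theorem norm_IStar_le {n : ℕ} (hn : 3 ≤ n) : ‖IStar n‖ ≤ 1053 * Real.log n ^ 2 := by
  refine ContinuousLinearMap.opNorm_le_bound _ (by positivity) fun f => ?_
  rw [ContinuousMap.norm_le _ (by positivity)]
  intro t
  rw [IStar_apply, mul_comm]
  refine (norm_sum_le _ _).trans ?_
  refine le_trans ?_ (mul_le_mul_of_nonneg_left (sum_norm_Phi_le hn t.2.1) (norm_nonneg f))
  rw [Finset.mul_sum, ← Finset.sum_coe_sort (KStar n)]
  refine Finset.sum_le_sum fun j _ => ?_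
  rw [norm_mul]
  gcongr
  exact f.norm_coe_le_norm _

theorem norm_L_le {n : ℕ} (hn : 3 ≤ n) : ‖L n‖ ≤ 6318 * Real.log n ^ 2 := by
  refine ContinuousLinearMap.opNorm_le_bound _ (by positivity) fun f => ?_
  rw [ContinuousMap.norm_le _ (by positivity)]
  intro t
  rw [L_apply, mul_comm]
  have hb : ∑ j ∈ UpsInt n, ‖ellInt n j t‖ ≤ 6318 * Real.log n ^ 2 := by
    refine (Finset.sum_le_sum fun j _ => norm_ellInt_le (by omega) j t).trans ?_
    rw [← Finset.mul_sum]
    have hS : UpsInt n ⊆ KStar n := fun j hj => Ups_subset_KStar n (UpsInt_sub hj)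
    linarith [sum_norm_Phi_act_le hn t.2.1 hS]
  refine (norm_sum_le _ _).trans ?_
  refine le_trans ?_ (mul_le_mul_of_nonneg_left hb (norm_nonneg f))
  rw [Finset.mul_sum, ← Finset.sum_coe_sort (UpsInt n)]
  refine Finset.sum_le_sum fun j _ => ?_
  rw [norm_mul]
  gcongr
  exact f.norm_coe_le_norm _

theorem norm_LStar_le {n : ℕ} (hn : 3 ≤ n) : ‖LStar n‖ ≤ 6318 * Real.log n ^ 2 := by
  refine ContinuousLinearMap.opNorm_le_bound _ (by positivity) fun f => ?_
  rw [ContinuousMap.norm_le _ (by positivity)]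
  intro t
  rw [LStar_apply, mul_comm]
  have hb : ∑ j ∈ Ups n, ‖ell n j t‖ ≤ 6318 * Real.log n ^ 2 := by
    refine (Finset.sum_le_sum fun j _ => norm_ell_le (by omega) j t).trans ?_
    rw [← Finset.mul_sum]
    linarith [sum_norm_Phi_act_le hn t.2.1 (Ups_subset_KStar n)]
  refine (norm_sum_le _ _).trans ?_
  refine le_trans ?_ (mul_le_mul_of_nonneg_left hb (norm_nonneg f))
  rw [Finset.mul_sum, ← Finset.sum_coe_sort (Ups n)]
  refine Finset.sum_le_sum fun j _ => ?_
  rw [norm_mul]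
  gcongr
  exact f.norm_coe_le_norm _

end

end HexFourier

theorem mainTheorem6 :
    ∃ c : ℝ, 0 < c ∧ ∀ n : ℕ, 0 < n → n ≡ 0 [MOD 3] →
      ‖HexFourier.IStar n‖ ≤ c * Real.log n ^ 2 ∧
      ‖HexFourier.L n‖ ≤ c * Real.log n ^ 2 ∧
      ‖HexFourier.LStar n‖ ≤ c * Real.log n ^ 2 := by
  -- `6318 = 1/6 * 36 * 1053`: the prefactor in `norm_ell_le` and `norm_ellInt_le`, the number of
  -- pairs of group elements, and the hexagon constant.
  refine ⟨6318, by norm_num, fun n hn h3 => ?_⟩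
  have hn3 : 3 ≤ n := Nat.le_of_dvd hn (Nat.modEq_zero_iff_dvd.mp h3)
  refine ⟨(HexFourier.norm_IStar_le hn3).trans ?_, HexFourier.norm_L_le hn3,
    HexFourier.norm_LStar_le hn3⟩
  gcongr
  norm_num
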